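/- **Conventions.** All information quantities are in nats. Let $F_X$ be a probability distribution on $\mathbb{R}^m$ and $e:\mathbb{R}^m\times\mathbb{R}^m\to[0,\infty)$ a measurable distortion measure. For $D\ge 0$ the distribution preserving rate-distortion function (DP-RDF) is $$R_{\mathrm{DP}}(D)=\inf_{F_{\tilde X|X}\in\mathcal F(D)} I(X;\tilde X)\in[0,\infty],\qquad \mathcal F(D)=\bigl\{F_{\tilde X|X}:\ \mathbb{E}\{e(X,\tilde X)\}\le D,\ F_{\tilde X}=F_X\bigr\},$$ where $X\sim F_X$, $F_{\tilde X|X}$ ranges over conditional distributions (Markov kernels) on $\mathbb{R}^m$, $I$ is mutual information (the Kullback-Leibler divergence of the joint law from the product of the marginals), and $\inf\emptyset=\infty$. A *quantizer ensemble* on a measurable space $A$ is a jointly measurable map $(x,\theta)\mapsto q(x|\theta)\in A$, with $\theta$ in some measurable space, such that each quantizer $q(\cdot|\theta)$ has a countable set of values and is equipped with a uniquely decodable code for these values, over a finite code alphabet of size $b\ge 2$ common to all $\theta$ (if $q(\cdot|\theta)$ has only one value, the empty codeword is also allowed). The quantizer is selected by a random element $\Theta$. The rate $\bar R(\theta)$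 of $q(\cdot|\theta)$ on a given source is $\log b$ times its expected codeword length under the law of the source, and the rate of the ensemble is $R=\mathbb{E}\{\bar R(\Theta)\}$. The ensemble is a *distribution preserving quantization (DPQ)* of the source if $\Theta$ is independent of the source and the reconstruction has the same distribution as the source. **Proposition (DP-RDF is a lower bound for DPQ).** Let $k\ge1$ and let $X_K=(X_1,\dots,X_k)$ be i.i.d. random vectors in $\mathbb{R}^m$ with distribution $F_X$. Let $\tilde X_K=q(X_K|\Theta)$ be any DPQ scheme for $X_K$ (on $A=(\mathbb{R}^m)^k$; in particular $\tilde X_K$ has the same joint distribution as $X_K$), with rate $R\in[0,\infty]$. Consider the single-letter fidelity criterion $$e_k(x_K,\tilde x_K)=k^{-1}\sum_{i=1}^k e(x_i,\tilde x_i).$$ If $D\ge 0$ and $\mathbb{E}\{e_k(X_K,\tilde X_K)\}\le D$, then the per-dimension rate of the scheme satisfies $$k^{-1}R\ \ge\ R_{\mathrm{DP}}(D).$$ -/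

import Mathlib

open MeasureTheory ProbabilityTheory
open scoped ENNReal NNReal

noncomputable section

/-- Mutual information `I(X ; X̃)`, in nats, of a pair with `X ∼ μ` and conditional distribution
`κ` of `X̃` given `X`: the Kullback-Leibler divergence of the joint law from the product of
its two marginals. It takes values in `[0, ∞]`. -/
def mutualInformation {A : Type*} [MeasurableSpace A] (μ : Measure A) (κ : Kernel A A) : ℝ≥0∞ :=
  InformationTheory.klDiv (μ.compProd κ) (μ.prod (μ.bind κ))

/-- The set `𝓕(D)` of conditional distributions of `X̃` given `X ∼ μ` with expected distortion
at most `D` and such that `X̃` has the same distribution as `X`. -/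
def distributionPreservingChannels {A : Type*} [MeasurableSpace A] (μ : Measure A)
    (e : A → A → ℝ≥0) (D : ℝ≥0) : Set (Kernel A A) :=
  {κ | IsMarkovKernel κ ∧ ∫⁻ p, (e p.1 p.2 : ℝ≥0∞) ∂(μ.compProd κ) ≤ D ∧ μ.bind κ = μ}

/-- The distribution preserving rate-distortion function (in nats) of the distribution `μ` and
the distortion measure `e`, with value `∞` where no channel is admissible. -/
def dpRDF {A : Type*} [MeasurableSpace A] (μ : Measure A) (e : A → A → ℝ≥0) (D : ℝ≥0) : ℝ≥0∞ :=
  ⨅ κ ∈ distributionPreservingChannels μ e D, mutualInformation μ κ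

/-- `c` is a uniquely decodable code for the set of symbols `S`: distinct symbols have distinct
codewords and the set of codewords is uniquely decodable. If there is only one symbol, nothing
has to be transmitted and any codeword, also the empty one (length zero), is admitted. -/
def IsUniquelyDecodableCode {A α : Type*} (S : Set A) (c : A → List α) : Prop :=
  Set.InjOn c S ∧ (InformationTheory.UniquelyDecodable (c '' S) ∨ S.Subsingleton)

/-- A quantizer ensemble `q(· | θ)` on `A`, with its quantizers selected by `θ : T`. Every
quantizer has a countable set of values and a uniquely decodable code for these values, with
codewords over the code alphabet `α`. -/
structure QuantizerEnsemble (A T α : Type*) [MeasurableSpace A] [MeasurableSpace T] where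
  quantizer : T → A → A
  measurable_quantizer : Measurable fun p : T × A => quantizer p.1 p.2
  countable_range : ∀ θ, (Set.range (quantizer θ)).Countable
  codeword : T → A → List α
  uniquelyDecodable : ∀ θ, IsUniquelyDecodableCode (Set.range (quantizer θ)) (codeword θ)

namespace QuantizerEnsemble

variable {A T α Ω : Type*} [MeasurableSpace A] [MeasurableSpace T] [MeasurableSpace Ω]

/-- The reconstruction `X̃ = q(X | Θ)`. -/
def reconstruction (q : QuantizerEnsemble A T α) (X : Ω → A) (Θ : Ω → T) : Ω → A :=
  fun ω => q.quantizer (Θ ω) (X ω)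

/-- The ensemble, with selection variable `Θ`, is a distribution preserving quantization of the
source `X`: the selection is independent of the source and the reconstruction has the same
distribution as the source. -/
def IsDPQ (q : QuantizerEnsemble A T α) (P : Measure Ω) (X : Ω → A) (Θ : Ω → T) : Prop :=
  IndepFun X Θ P ∧ P.map (q.reconstruction X Θ) = P.map X

/-- The rate (in nats) of the individual quantizer `q(· | θ)` on a source with law `ν`: its
expected codeword length, where each code letter counts as `log |α|` nats. -/
def quantizerRate [Fintype α] (q : QuantizerEnsemble A T α) (ν : Measure A) (θ : T) : ℝ≥0∞ :=
  ENNReal.ofReal (Real.log (Fintype.card α)) *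
    ∫⁻ x, ((q.codeword θ (q.quantizer θ x)).length : ℝ≥0∞) ∂ν

/-- The rate of the ensemble: the expected rate `E[R̄(Θ)]` of its individual quantizers, where
the source has the law of `X` and the quantizer is selected with the law of `Θ`. -/
def rate [Fintype α] (q : QuantizerEnsemble A T α) (P : Measure Ω) (X : Ω → A) (Θ : Ω → T) :
    ℝ≥0∞ :=
  ∫⁻ θ, q.quantizerRate (P.map X) θ ∂(P.map Θ)

end QuantizerEnsemble

/-- The single-letter fidelity criterion `e_k(x, y) = k⁻¹ ∑ i, e(x_i, y_i)`. -/
def singleLetterFidelity {A : Type*} (e : A → A → ℝ≥0) {k : ℕ} (x y : Fin k → A) : ℝ≥0 :=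
  (k : ℝ≥0)⁻¹ * ∑ i, e (x i) (y i)

end

/-!
Information is superadditive over independent letters, so `∑ i, I(Xᵢ ; X̃ᵢ) ≤ I(X ; X̃)`. Choosing a
letter uniformly at random (time sharing) gives a coupling of `μ` with itself whose distortion is
the average of the letter distortions, and by joint convexity of the Kullback-Leibler divergence its
information is at most the average of the `I(Xᵢ ; X̃ᵢ)`. This is where preservation of the
distribution matters: all the letter couplings have the same marginals, hence so does their mixture.

On the coding side, `Θ` is independent of `X`, so the same convexity gives
`I(X ; X̃) ≤ E[I(X ; q(X | θ))]` with `θ` of the law of `Θ`. Since `q(X | θ)` is a function of `X`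
with countably many values, its information about `X` is its Shannon entropy, which by Gibbs'
inequality with the Kraft-McMillan weights `b ^ (-length)` is at most the expected codeword length
times `log b`.
-/

open InformationTheory

section KullbackLeibler

variable {A B : Type*} [MeasurableSpace A] [MeasurableSpace B]

theorem rnDeriv_compProd_right_ae_eq [MeasurableSpace.CountableOrCountablyGenerated A B]
    {μ : Measure A} [IsFiniteMeasure μ] {κ η : Kernel A B} [IsFiniteKernel κ] [IsFiniteKernel η]
    (hκη : ∀ᵐ a ∂μ, κ a ≪ η a) :
    (μ ⊗ₘ κ).rnDeriv (μ ⊗ₘ η) =ᵐ[μ ⊗ₘ η] fun p ↦ κ.rnDeriv η p.1 p.2 := by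
  have h_density : μ ⊗ₘ κ = (μ ⊗ₘ η).withDensity fun p ↦ κ.rnDeriv η p.1 p.2 := by
    rw [← Measure.compProd_withDensity (by fun_prop)]
    refine Measure.compProd_congr ?_
    filter_upwards [hκη] with a ha using (Kernel.withDensity_rnDeriv_eq ha).symm
  rw [h_density]
  exact Measure.rnDeriv_withDensity _ (by fun_prop)

theorem klDiv_compProd_eq_lintegral [MeasurableSpace.CountableOrCountablyGenerated A B]
    (μ : Measure A) [IsFiniteMeasure μ] (κ η : Kernel A B) [IsFiniteKernel κ] [IsFiniteKernel η] :
    klDiv (μ ⊗ₘ κ) (μ ⊗ₘ η) = ∫⁻ a, klDiv (κ a) (η a) ∂μ := by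
  by_cases hκη : ∀ᵐ a ∂μ, κ a ≪ η a
  · rw [klDiv_eq_lintegral_klFun_of_ac (Measure.AbsolutelyContinuous.compProd_right hκη)]
    calc ∫⁻ p, ENNReal.ofReal (klFun ((μ ⊗ₘ κ).rnDeriv (μ ⊗ₘ η) p).toReal) ∂(μ ⊗ₘ η)
      _ = ∫⁻ p, ENNReal.ofReal (klFun (κ.rnDeriv η p.1 p.2).toReal) ∂(μ ⊗ₘ η) := by
        refine lintegral_congr_ae ?_
        filter_upwards [rnDeriv_compProd_right_ae_eq hκη] with p hp
        rw [hp]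
      _ = ∫⁻ a, ∫⁻ b, ENNReal.ofReal (klFun (κ.rnDeriv η a b).toReal) ∂(η a) ∂μ :=
        Measure.lintegral_compProd (by fun_prop)
      _ = ∫⁻ a, klDiv (κ a) (η a) ∂μ := by
        refine lintegral_congr_ae ?_
        filter_upwards [hκη] with a ha
        rw [klDiv_eq_lintegral_klFun_of_ac ha]
        refine lintegral_congr_ae ?_
        filter_upwards [Kernel.rnDeriv_eq_rnDeriv_measure (κ := κ) (η := η) (a := a)] with b hb
        rw [hb]
  · have h_not_ac : ¬ μ ⊗ₘ κ ≪ μ ⊗ₘ η := by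
      rwa [Measure.absolutelyContinuous_compProd_right_iff]
    rw [klDiv_of_not_ac h_not_ac, eq_comm, ← top_le_iff]
    calc ∞ = ∞ * μ {a | κ a ≪ η a}ᶜ := (ENNReal.top_mul hκη).symm
      _ = ∫⁻ _ in {a | κ a ≪ η a}ᶜ, ∞ ∂μ := (setLIntegral_const _ _).symm
      _ ≤ ∫⁻ a in {a | κ a ≪ η a}ᶜ, klDiv (κ a) (η a) ∂μ :=
        setLIntegral_mono' (Kernel.measurableSet_absolutelyContinuous κ η).compl
          fun a ha ↦ (klDiv_of_not_ac ha).ge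
      _ ≤ ∫⁻ a, klDiv (κ a) (η a) ∂μ := setLIntegral_le_lintegral _ _

theorem klDiv_comp_le_lintegral [MeasurableSpace.CountableOrCountablyGenerated A B]
    (μ : Measure A) [IsFiniteMeasure μ] (κ η : Kernel A B) [IsFiniteKernel κ] [IsFiniteKernel η] :
    klDiv (κ ∘ₘ μ) (η ∘ₘ μ) ≤ ∫⁻ a, klDiv (κ a) (η a) ∂μ := by
  rw [← klDiv_compProd_eq_lintegral, ← Measure.snd_compProd μ κ, ← Measure.snd_compProd μ η]
  exact klDiv_map_le _ _ measurable_snd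

theorem klDiv_cond {ν : Measure A} [IsProbabilityMeasure ν] {s : Set A} (hs : MeasurableSet s)
    (hνs : ν s ≠ 0) : klDiv ν[|s] ν = ENNReal.ofReal (-Real.log (ν.real s)) := by
  have : IsProbabilityMeasure ν[|s] := cond_isProbabilityMeasure hνs
  have h_inv : (ν s)⁻¹ ≠ ∞ := ENNReal.inv_ne_top.2 hνs
  have h_rnDeriv : ν[|s].rnDeriv ν =ᵐ[ν[|s]] fun _ ↦ (ν s)⁻¹ := by
    have h_restrict : ν[|s].rnDeriv ν =ᵐ[ν] fun a ↦ (ν s)⁻¹ * s.indicator 1 a := by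
      filter_upwards [Measure.rnDeriv_smul_left_of_ne_top' (ν.restrict s) ν h_inv,
        Measure.rnDeriv_restrict_self ν hs] with a h_smul h_ind
      rw [ProbabilityTheory.cond, h_smul, Pi.smul_apply, h_ind, smul_eq_mul]
    filter_upwards [cond_absolutelyContinuous.ae_le h_restrict, ae_cond_mem hs] with a ha has
    rw [ha, Set.indicator_of_mem has, Pi.one_apply, mul_one]
  have h_llr : llr ν[|s] ν =ᵐ[ν[|s]] fun _ ↦ -Real.log (ν.real s) := by
    filter_upwards [h_rnDeriv] with a ha
    rw [llr, ha, ENNReal.toReal_inv, Real.log_inv, measureReal_def]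
  rw [klDiv_of_ac_of_integrable cond_absolutelyContinuous
    ((integrable_const _).congr h_llr.symm), integral_congr_ae h_llr]
  simp

end KullbackLeibler

section MutualInfo

/-- The mutual information `I(X ; Y)`, in nats, of two random variables on a common probability
space. It complements `mutualInformation`, which describes the pair by the law of `X` and the
conditional law of `Y`. -/
noncomputable def mutualInfo {Ω A B : Type*} [MeasurableSpace Ω] [MeasurableSpace A]
    [MeasurableSpace B] (X : Ω → A) (Y : Ω → B) (P : Measure Ω) : ℝ≥0∞ :=
  klDiv (P.map fun ω ↦ (X ω, Y ω)) ((P.map X).prod (P.map Y))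

variable {Ω A B C A' B' T : Type*} [MeasurableSpace Ω] [MeasurableSpace A] [MeasurableSpace B]
  [MeasurableSpace C] [MeasurableSpace A'] [MeasurableSpace B'] [MeasurableSpace T]
  {P : Measure Ω}

theorem mutualInfo_comp_le [IsFiniteMeasure P] {X : Ω → A} {Y : Ω → B} (hX : Measurable X)
    (hY : Measurable Y) {f : A → A'} {g : B → B'} (hf : Measurable f) (hg : Measurable g) :
    mutualInfo (fun ω ↦ f (X ω)) (fun ω ↦ g (Y ω)) P ≤ mutualInfo X Y P := by
  have h_joint : (P.map fun ω ↦ (X ω, Y ω)).map (Prod.map f g) =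
      P.map fun ω ↦ (f (X ω), g (Y ω)) := Measure.map_map (by fun_prop) (by fun_prop)
  have h_prod : ((P.map X).prod (P.map Y)).map (Prod.map f g) =
      (P.map fun ω ↦ f (X ω)).prod (P.map fun ω ↦ g (Y ω)) := by
    rw [← Measure.map_prod_map _ _ hf hg, Measure.map_map hf hX, Measure.map_map hg hY]
    rfl
  rw [mutualInfo, mutualInfo, ← h_joint, ← h_prod]
  exact klDiv_map_le _ _ (by fun_prop)

theorem mutualInfo_le_swap [IsFiniteMeasure P] {X : Ω → A} {Y : Ω → B} (hX : Measurable X)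
    (hY : Measurable Y) :
    mutualInfo X Y P ≤ mutualInfo Y X P := by
  have h_joint : (P.map fun ω ↦ (Y ω, X ω)).map Prod.swap = P.map fun ω ↦ (X ω, Y ω) :=
    Measure.map_map measurable_swap (by fun_prop)
  rw [mutualInfo, mutualInfo, ← h_joint, ← Measure.prod_swap]
  exact klDiv_map_le _ _ measurable_swap

theorem mutualInfo_comm [IsFiniteMeasure P] {X : Ω → A} {Y : Ω → B} (hX : Measurable X)
    (hY : Measurable Y) :
    mutualInfo X Y P = mutualInfo Y X P :=
  le_antisymm (mutualInfo_le_swap hX hY) (mutualInfo_le_swap hY hX)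

theorem mutualInfo_eq_lintegral_condDistrib [IsFiniteMeasure P] [StandardBorelSpace B]
    [Nonempty B] {X : Ω → A} {Y : Ω → B} (hY : Measurable Y) :
    mutualInfo X Y P = ∫⁻ x, klDiv (condDistrib Y X P x) (P.map Y) ∂(P.map X) := by
  rw [mutualInfo, ← compProd_map_condDistrib hY.aemeasurable, ← Measure.compProd_const,
    klDiv_compProd_eq_lintegral]
  simp only [Kernel.const_apply]

theorem const_prod_comp (ν : Measure A) [IsFiniteMeasure ν] (τ : Measure T)
    [IsFiniteMeasure τ] (κ : Kernel T B) [IsFiniteKernel κ] :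
    (Kernel.const T ν ×ₖ κ) ∘ₘ τ = ν.prod (κ ∘ₘ τ) := by
  refine Measure.ext_prod fun {s t} hs ht ↦ ?_
  rw [Measure.prod_prod, Measure.bind_apply (hs.prod ht) (Kernel.aemeasurable _),
    Measure.bind_apply ht (Kernel.aemeasurable _), ← lintegral_const_mul _ (κ.measurable_coe ht)]
  simp only [Kernel.prod_apply_prod, Kernel.const_apply]

variable [IsProbabilityMeasure P]

theorem klDiv_map_prodMk_prod_eq_add [StandardBorelSpace B] [Nonempty B] {X : Ω → A} {Y : Ω → B}
    (hY : Measurable Y) (ρ : Measure A) [IsFiniteMeasure ρ] :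
    klDiv (P.map fun ω ↦ (X ω, Y ω)) (ρ.prod (P.map Y)) =
      klDiv (P.map X) ρ + mutualInfo X Y P := by
  have : IsProbabilityMeasure (P.map Y) := Measure.isProbabilityMeasure_map hY.aemeasurable
  rw [mutualInfo, ← compProd_map_condDistrib hY.aemeasurable, ← Measure.compProd_const,
    ← Measure.compProd_const, klDiv_compProd_eq_add]

theorem mutualInfo_add_le_of_indepFun [StandardBorelSpace A] [Nonempty A] {X : Ω → A} {Y : Ω → B}
    {Z : Ω → C} (hX : Measurable X) (hY : Measurable Y) (hZ : Measurable Z)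
    (h_indep : IndepFun X Y P) :
    mutualInfo X Z P + mutualInfo Y Z P ≤ mutualInfo (fun ω ↦ (X ω, Y ω)) Z P := by
  have : IsProbabilityMeasure (P.map X) := Measure.isProbabilityMeasure_map hX.aemeasurable
  have : IsProbabilityMeasure (P.map Y) := Measure.isProbabilityMeasure_map hY.aemeasurable
  have : IsProbabilityMeasure (P.map Z) := Measure.isProbabilityMeasure_map hZ.aemeasurable
  let rotate : (A × B) × C → (B × C) × A := Prod.swap ∘ MeasurableEquiv.prodAssoc
  have h_rotate : Measurable rotate := by fun_prop
  have h_joint : (P.map fun ω ↦ ((X ω, Y ω), Z ω)).map rotate =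
      P.map fun ω ↦ ((Y ω, Z ω), X ω) := Measure.map_map h_rotate (by fun_prop)
  have h_prod : ((P.map fun ω ↦ (X ω, Y ω)).prod (P.map Z)).map rotate =
      ((P.map Y).prod (P.map Z)).prod (P.map X) := by
    rw [(indepFun_iff_map_prod_eq_prod_map_map hX.aemeasurable hY.aemeasurable).1 h_indep,
      ← Measure.map_map measurable_swap (MeasurableEquiv.measurable _), Measure.prodAssoc_prod,
      Measure.prod_swap]
  calc mutualInfo X Z P + mutualInfo Y Z P
    _ ≤ mutualInfo (fun ω ↦ (Y ω, Z ω)) X P + mutualInfo Y Z P := by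
      gcongr
      rw [mutualInfo_comm hX hZ]
      exact mutualInfo_comp_le (hY.prodMk hZ) hX measurable_snd measurable_id
    _ = klDiv (P.map fun ω ↦ ((Y ω, Z ω), X ω)) (((P.map Y).prod (P.map Z)).prod (P.map X)) := by
      rw [klDiv_map_prodMk_prod_eq_add hX, add_comm, ← mutualInfo]
    _ ≤ mutualInfo (fun ω ↦ (X ω, Y ω)) Z P := by
      rw [← h_joint, ← h_prod]
      exact klDiv_map_le _ _ h_rotate

theorem sum_mutualInfo_le_of_iIndepFun {ι : Type*} [Fintype ι] {E : ι → Type*}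
    [∀ i, MeasurableSpace (E i)] [∀ i, StandardBorelSpace (E i)] {X : ∀ i, Ω → E i} {Z : Ω → C}
    (hX : ∀ i, Measurable (X i)) (hZ : Measurable Z) (h_indep : iIndepFun X P) :
    ∑ i, mutualInfo (X i) Z P ≤ mutualInfo (fun ω i ↦ X i ω) Z P := by
  classical
  have h_finset (S : Finset ι) :
      ∑ i ∈ S, mutualInfo (X i) Z P ≤ mutualInfo (fun ω (i : S) ↦ X i ω) Z P := by
    induction S using Finset.induction with
    | empty => simp
    | insert j S hj ih =>
      have : Nonempty (E j) := (nonempty_of_isProbabilityMeasure P).map (X j)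
      have h_indep_j : IndepFun (X j) (fun ω (i : S) ↦ X i ω) P :=
        (h_indep.indepFun_finset {j} S (Finset.disjoint_singleton_left.2 hj) hX).comp
          (measurable_pi_apply (⟨j, Finset.mem_singleton_self j⟩ : ({j} : Finset ι)))
          measurable_id
      rw [Finset.sum_insert hj]
      calc mutualInfo (X j) Z P + ∑ i ∈ S, mutualInfo (X i) Z P
        _ ≤ mutualInfo (X j) Z P + mutualInfo (fun ω (i : S) ↦ X i ω) Z P := by gcongr
        _ ≤ mutualInfo (fun ω ↦ (X j ω, fun i : S ↦ X i ω)) Z P :=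
          mutualInfo_add_le_of_indepFun (hX j) (by fun_prop) hZ h_indep_j
        _ ≤ mutualInfo (fun ω (i : ↥(insert j S)) ↦ X i ω) Z P :=
          mutualInfo_comp_le (f := fun x : ∀ i : ↥(insert j S), E i ↦
            (x ⟨j, Finset.mem_insert_self j S⟩,
              fun i : S ↦ x ⟨i, Finset.mem_insert_of_mem i.2⟩))
            (by fun_prop) hZ (by fun_prop) measurable_id
  exact (h_finset Finset.univ).trans <|
    mutualInfo_comp_le (f := fun (x : ∀ i, E i) (i : (Finset.univ : Finset ι)) ↦ x i)
      (by fun_prop) hZ (by fun_prop) measurable_id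

theorem mutualInfo_le_lintegral_of_indepFun [MeasurableSpace.CountablyGenerated A]
    [MeasurableSpace.CountablyGenerated B] {X : Ω → A} {Θ : Ω → T} (hX : Measurable X)
    (hΘ : Measurable Θ) (h_indep : IndepFun X Θ P) {f : T × A → B} (hf : Measurable f) :
    mutualInfo X (fun ω ↦ f (Θ ω, X ω)) P ≤
      ∫⁻ θ, mutualInfo id (fun x ↦ f (θ, x)) (P.map X) ∂(P.map Θ) := by
  have : IsProbabilityMeasure (P.map X) := Measure.isProbabilityMeasure_map hX.aemeasurable
  have : IsProbabilityMeasure (P.map Θ) := Measure.isProbabilityMeasure_map hΘ.aemeasurable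
  set ν := P.map X
  set τ := P.map Θ
  let source : Kernel T (T × A) := Kernel.id ×ₖ Kernel.const T ν
  let joint : Kernel T (A × B) := source.map fun z ↦ (z.2, f z)
  let marginals : Kernel T (A × B) := Kernel.const T ν ×ₖ source.map f
  have h_law : P.map (fun ω ↦ (Θ ω, X ω)) = source ∘ₘ τ := by
    rw [(indepFun_iff_map_prod_eq_prod_map_map hΘ.aemeasurable hX.aemeasurable).1 h_indep.symm,
      ← Measure.compProd_const, Measure.compProd_eq_comp_prod]
  have h_joint : P.map (fun ω ↦ (X ω, f (Θ ω, X ω))) = joint ∘ₘ τ := by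
    rw [← Measure.map_comp _ _ (by fun_prop), ← h_law, Measure.map_map (by fun_prop) (by fun_prop)]
    rfl
  have h_marginals : ν.prod (P.map fun ω ↦ f (Θ ω, X ω)) = marginals ∘ₘ τ := by
    rw [const_prod_comp, ← Measure.map_comp _ _ hf, ← h_law, Measure.map_map hf (by fun_prop)]
    rfl
  have h_source (θ : T) : source θ = ν.map (Prod.mk θ) := by
    rw [Kernel.prod_apply, Kernel.id_apply, Kernel.const_apply, Measure.dirac_prod]
  rw [mutualInfo, h_joint, h_marginals]
  refine (klDiv_comp_le_lintegral τ joint marginals).trans_eq (lintegral_congr fun θ ↦ ?_)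
  have h_joint_apply : joint θ = ν.map fun x ↦ (x, f (θ, x)) := by
    rw [Kernel.map_apply _ (by fun_prop), h_source, Measure.map_map (by fun_prop) (by fun_prop)]
    rfl
  have h_marginals_apply : marginals θ = ν.prod (ν.map fun x ↦ f (θ, x)) := by
    rw [Kernel.prod_apply, Kernel.const_apply, Kernel.map_apply _ hf, h_source,
      Measure.map_map hf (by fun_prop)]
    rfl
  rw [h_joint_apply, h_marginals_apply, mutualInfo, Measure.map_id]
  rfl

end MutualInfo

section Entropy

/-- The Shannon entropy, in nats, of a probability measure carried by a countable set: the
expected self-information. Since `Real.log 0 = 0`, a measure without atoms gets entropy `0`. -/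
noncomputable def shannonEntropy {B : Type*} [MeasurableSpace B] (π : Measure B) : ℝ≥0∞ :=
  ∫⁻ b, ENNReal.ofReal (-Real.log (π.real {b})) ∂π

variable {A B : Type*} [MeasurableSpace A] [MeasurableSpace B]

theorem ae_measure_singleton_ne_zero {π : Measure B} {C : Set B} (hC : C.Countable)
    (hπC : ∀ᵐ b ∂π, b ∈ C) : ∀ᵐ b ∂π, π {b} ≠ 0 := by
  have h_null : π {b ∈ C | π {b} = 0} = 0 := by
    rw [← Set.biUnion_of_singleton {b ∈ C | π {b} = 0},
      measure_biUnion_null_iff (hC.mono (Set.sep_subset _ _))]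
    exact fun b hb ↦ hb.2
  filter_upwards [hπC, measure_eq_zero_iff_ae_notMem.1 h_null] with b hbC hb h_zero
    using hb ⟨hbC, h_zero⟩

-- Stated without subtraction, so that it can be summed in `ℝ≥0∞`.
theorem neg_log_mul_add_le {p r : ℝ} (hp : 0 ≤ p) (hr : 0 < r) :
    -Real.log p * p + p ≤ -Real.log r * p + r := by
  rcases hp.eq_or_lt with rfl | hp
  · simpa using hr.le
  · have h_log : Real.log r - Real.log p ≤ r / p - 1 :=
      Real.log_div hr.ne' hp.ne' ▸ Real.log_le_sub_one_of_pos (div_pos hr hp)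
    have h_cancel : r / p * p = r := div_mul_cancel₀ r hp.ne'
    nlinarith [mul_le_mul_of_nonneg_right h_log hp.le]

theorem ofReal_neg_log_mul_add_le {π : Measure B} [IsProbabilityMeasure π] {r : ℝ} (hr : 0 < r)
    (s : Set B) :
    ENNReal.ofReal (-Real.log (π.real s)) * π s + π s ≤
      ENNReal.ofReal (-Real.log r) * π s + ENNReal.ofReal r := by
  have h_log : 0 ≤ -Real.log (π.real s) :=
    neg_nonneg.2 (Real.log_nonpos measureReal_nonneg measureReal_le_one)
  rw [← ofReal_measureReal (μ := π) (s := s), ← ENNReal.ofReal_mul h_log,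
    ← ENNReal.ofReal_mul' measureReal_nonneg,
    ← ENNReal.ofReal_add (mul_nonneg h_log measureReal_nonneg) measureReal_nonneg]
  exact (ENNReal.ofReal_le_ofReal (neg_log_mul_add_le measureReal_nonneg hr)).trans
    ENNReal.ofReal_add_le

variable [MeasurableSingletonClass B]

theorem condDistrib_id_apply_eq_cond [StandardBorelSpace A] [Nonempty A] {ν : Measure A}
    [IsFiniteMeasure ν] {f : A → B} (hf : Measurable f) {b : B} (hb : ν.map f {b} ≠ 0) :
    condDistrib id f ν b = ν[|f ⁻¹' {b}] := by
  ext s hs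
  rw [condDistrib_apply_of_ne_zero (X := f) (Y := id) measurable_id b hb,
    cond_apply (hf (measurableSet_singleton b)),
    Measure.map_apply hf (measurableSet_singleton b),
    Measure.map_apply (by fun_prop) ((measurableSet_singleton b).prod hs)]
  rfl

theorem mutualInfo_id_eq_shannonEntropy [StandardBorelSpace A] {ν : Measure A}
    [IsProbabilityMeasure ν] {f : A → B} (hf : Measurable f)
    (hf_range : (Set.range f).Countable) :
    mutualInfo id f ν = shannonEntropy (ν.map f) := by
  have : Nonempty A := nonempty_of_isProbabilityMeasure ν
  have h_carried : ∀ᵐ b ∂ν.map f, b ∈ Set.range f := ae_map_mem_range f hf_range.measurableSet ν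
  rw [mutualInfo_comm measurable_id hf,
    mutualInfo_eq_lintegral_condDistrib (X := f) (Y := id) measurable_id, Measure.map_id]
  refine lintegral_congr_ae ?_
  filter_upwards [ae_measure_singleton_ne_zero hf_range h_carried] with b hb
  have h_fiber : ν.map f {b} = ν (f ⁻¹' {b}) := Measure.map_apply hf (measurableSet_singleton b)
  rw [condDistrib_id_apply_eq_cond hf hb,
    klDiv_cond (hf (measurableSet_singleton b)) (h_fiber ▸ hb), measureReal_def, measureReal_def,
    h_fiber]

theorem shannonEntropy_le_lintegral_neg_log {π : Measure B} [IsProbabilityMeasure π] {C : Set B}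
    (hC : C.Countable) (hπC : ∀ᵐ b ∂π, b ∈ C) {r : B → ℝ} (hr : ∀ b ∈ C, 0 < r b)
    (hr_sum : ∑' b : C, ENNReal.ofReal (r b) ≤ 1) :
    shannonEntropy π ≤ ∫⁻ b, ENNReal.ofReal (-Real.log (r b)) ∂π := by
  have h_lintegral (g : B → ℝ≥0∞) : ∫⁻ b, g b ∂π = ∑' b : C, g b * π {(b : B)} := by
    rw [← lintegral_countable g hC, Measure.restrict_eq_self_of_ae_mem hπC]
  have h_mass : ∑' b : C, π {(b : B)} = 1 := by simpa using (h_lintegral 1).symm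
  refine (ENNReal.add_le_add_iff_right ENNReal.one_ne_top).1 ?_
  calc shannonEntropy π + 1
    _ = ∑' b : C, (ENNReal.ofReal (-Real.log (π.real {(b : B)})) * π {(b : B)} + π {(b : B)}) := by
      rw [ENNReal.tsum_add, h_mass, shannonEntropy, h_lintegral]
    _ ≤ ∑' b : C, (ENNReal.ofReal (-Real.log (r b)) * π {(b : B)} + ENNReal.ofReal (r b)) :=
      ENNReal.tsum_le_tsum fun b ↦ ofReal_neg_log_mul_add_le (hr b b.2) {(b : B)}
    _ ≤ ∫⁻ b, ENNReal.ofReal (-Real.log (r b)) ∂π + 1 := by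
      rw [ENNReal.tsum_add, h_lintegral]
      exact add_le_add_right hr_sum _

theorem shannonEntropy_eq_zero_of_subsingleton {π : Measure B} [IsProbabilityMeasure π]
    {C : Set B} (hC : C.Subsingleton) (hπC : ∀ᵐ b ∂π, b ∈ C) : shannonEntropy π = 0 := by
  refine (lintegral_congr_ae ?_).trans lintegral_zero
  filter_upwards [hπC] with b hb
  have h_mass : π {b} = 1 :=
    (mem_ae_iff_prob_eq_one (measurableSet_singleton b)).1 (hπC.mono fun x hx ↦ hC hx hb)
  simp [measureReal_def, h_mass]

end Entropy

section Coding

variable {B α : Type*} [Fintype α] [Nonempty α]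

theorem tsum_inv_card_pow_length_le_one {C : Set B} {c : B → List α} (hc : Set.InjOn c C)
    (h_decodable : UniquelyDecodable (c '' C)) :
    ∑' b : C, ENNReal.ofReal ((1 / Fintype.card α : ℝ) ^ (c b).length) ≤ 1 := by
  classical
  rw [ENNReal.tsum_eq_iSup_sum]
  refine iSup_le fun F ↦ ?_
  have h_subset : ((F.image fun b : C ↦ c b : Finset (List α)) : Set (List α)) ⊆ c '' C := by
    rw [Finset.coe_image, Set.image_subset_iff]
    exact fun b _ ↦ Set.mem_image_of_mem c b.2
  have h_kraft := kraft_mcmillan_inequality (S := F.image fun b : C ↦ c b) fun L₁ L₂ h₁ h₂ ↦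
    h_decodable L₁ L₂ (fun w hw ↦ h_subset (h₁ w hw)) fun w hw ↦ h_subset (h₂ w hw)
  rw [Finset.sum_image fun b _ b' _ h ↦ Subtype.ext (hc b.2 b'.2 h)] at h_kraft
  rw [← ENNReal.ofReal_sum_of_nonneg fun _ _ ↦ by positivity]
  exact ENNReal.ofReal_le_one.2 h_kraft

theorem shannonEntropy_le_mul_lintegral_length [MeasurableSpace B] [MeasurableSingletonClass B]
    {π : Measure B} [IsProbabilityMeasure π] {C : Set B} (hC : C.Countable)
    (hπC : ∀ᵐ b ∂π, b ∈ C) {c : B → List α} (hc : IsUniquelyDecodableCode C c) :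
    shannonEntropy π ≤
      ENNReal.ofReal (Real.log (Fintype.card α)) * ∫⁻ b, ((c b).length : ℝ≥0∞) ∂π := by
  rcases hc with ⟨hc_inj, h_decodable | h_subsingleton⟩
  · have h_length (n : ℕ) : ENNReal.ofReal (-Real.log ((1 / Fintype.card α : ℝ) ^ n)) =
        ENNReal.ofReal (Real.log (Fintype.card α)) * n := by
      rw [Real.log_pow, one_div, Real.log_inv, mul_neg, neg_neg, ENNReal.ofReal_mul n.cast_nonneg,
        ENNReal.ofReal_natCast, mul_comm]
    have h_gibbs := shannonEntropy_le_lintegral_neg_log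
      (r := fun b ↦ (1 / Fintype.card α : ℝ) ^ (c b).length) hC hπC (fun _ _ ↦ by positivity)
      (tsum_inv_card_pow_length_le_one hc_inj h_decodable)
    simp only [h_length] at h_gibbs
    rwa [lintegral_const_mul' _ _ ENNReal.ofReal_ne_top] at h_gibbs
  · rw [shannonEntropy_eq_zero_of_subsingleton h_subsingleton hπC]
    exact zero_le

end Coding

namespace QuantizerEnsemble

variable {Ω T A α : Type*} [MeasurableSpace Ω] [MeasurableSpace T] [MeasurableSpace A]

theorem measurable_reconstruction (q : QuantizerEnsemble A T α) {X : Ω → A} {Θ : Ω → T}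
    (hX : Measurable X) (hΘ : Measurable Θ) : Measurable (q.reconstruction X Θ) :=
  q.measurable_quantizer.comp (hΘ.prodMk hX)

theorem measurable_quantizer_apply (q : QuantizerEnsemble A T α) (θ : T) :
    Measurable (q.quantizer θ) :=
  q.measurable_quantizer.comp measurable_prodMk_left

variable [StandardBorelSpace A] [Fintype α] [Nonempty α]

theorem mutualInfo_quantizer_le_quantizerRate (q : QuantizerEnsemble A T α) (ν : Measure A)
    [IsProbabilityMeasure ν] (θ : T) :
    mutualInfo id (q.quantizer θ) ν ≤ q.quantizerRate ν θ := by
  have h_meas := q.measurable_quantizer_apply θ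
  have h_countable := q.countable_range θ
  have : IsProbabilityMeasure (ν.map (q.quantizer θ)) :=
    Measure.isProbabilityMeasure_map h_meas.aemeasurable
  calc mutualInfo id (q.quantizer θ) ν
    _ = shannonEntropy (ν.map (q.quantizer θ)) := mutualInfo_id_eq_shannonEntropy h_meas h_countable
    _ ≤ ENNReal.ofReal (Real.log (Fintype.card α)) *
          ∫⁻ y, ((q.codeword θ y).length : ℝ≥0∞) ∂ν.map (q.quantizer θ) :=
      shannonEntropy_le_mul_lintegral_length h_countable
        (ae_map_mem_range _ h_countable.measurableSet ν) (q.uniquelyDecodable θ)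
    _ ≤ q.quantizerRate ν θ := by
      rw [quantizerRate]
      exact mul_le_mul' le_rfl (lintegral_map_le _ _)

theorem mutualInfo_reconstruction_le_rate (q : QuantizerEnsemble A T α) {P : Measure Ω}
    [IsProbabilityMeasure P] {X : Ω → A} {Θ : Ω → T} (hX : Measurable X) (hΘ : Measurable Θ)
    (h_indep : IndepFun X Θ P) :
    mutualInfo X (q.reconstruction X Θ) P ≤ q.rate P X Θ := by
  have : IsProbabilityMeasure (P.map X) := Measure.isProbabilityMeasure_map hX.aemeasurable
  exact (mutualInfo_le_lintegral_of_indepFun hX hΘ h_indep q.measurable_quantizer).trans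
    (lintegral_mono fun θ ↦ q.mutualInfo_quantizer_le_quantizerRate (P.map X) θ)

end QuantizerEnsemble

section RateDistortion

variable {ι E Ω : Type*} [MeasurableSpace ι] [MeasurableSpace E] [MeasurableSpace Ω]
  {e : E → E → ℝ≥0}

theorem lintegral_uniformOn_univ [Fintype ι] [MeasurableSingletonClass ι] (f : ι → ℝ≥0∞) :
    ∫⁻ i, f i ∂(uniformOn Set.univ) = (Fintype.card ι : ℝ≥0∞)⁻¹ * ∑ i, f i := by
  rw [lintegral_fintype, Finset.mul_sum]
  refine Finset.sum_congr rfl fun i _ ↦ ?_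
  rw [uniformOn_univ, Measure.count_singleton, one_div, mul_comm]

theorem lintegral_singleLetterFidelity {P : Measure Ω} {k : ℕ}
    (he : Measurable (Function.uncurry e)) {X Y : Ω → Fin k → E} (hX : Measurable X)
    (hY : Measurable Y) :
    ∫⁻ ω, (singleLetterFidelity e (X ω) (Y ω) : ℝ≥0∞) ∂P =
      (k : ℝ≥0∞)⁻¹ * ∑ i, ∫⁻ ω, (e (X ω i) (Y ω i) : ℝ≥0∞) ∂P := by
  have h_letter (i : Fin k) : Measurable fun ω ↦ (e (X ω i) (Y ω i) : ℝ≥0∞) :=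
    he.coe_nnreal_ennreal.comp (by fun_prop : Measurable fun ω ↦ (X ω i, Y ω i))
  rw [← lintegral_finsetSum _ fun i _ ↦ h_letter i,
    ← lintegral_const_mul _ (Finset.measurable_fun_sum _ fun i _ ↦ h_letter i)]
  refine lintegral_congr fun ω ↦ ?_
  rcases k.eq_zero_or_pos with rfl | hk
  · simp [singleLetterFidelity]
  · rw [singleLetterFidelity, ENNReal.coe_mul, ENNReal.coe_inv (by positivity)]
    push_cast
    rfl

variable [StandardBorelSpace E] {μ : Measure E} [IsProbabilityMeasure μ] {D : ℝ≥0}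

theorem dpRDF_le_klDiv_of_coupling {Q : Measure (E × E)} [IsFiniteMeasure Q] (h_fst : Q.fst = μ)
    (h_snd : Q.snd = μ) (h_distortion : ∫⁻ p, (e p.1 p.2 : ℝ≥0∞) ∂Q ≤ D) :
    dpRDF μ e D ≤ klDiv Q (μ.prod μ) := by
  have : Nonempty E := nonempty_of_isProbabilityMeasure μ
  have h_disintegrate : μ ⊗ₘ Q.condKernel = Q := h_fst ▸ Q.disintegrate Q.condKernel
  have h_bind : μ.bind Q.condKernel = μ := by
    rw [← Measure.snd_compProd, h_disintegrate, h_snd]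
  refine (iInf₂_le Q.condKernel
    ⟨inferInstance, h_disintegrate.symm ▸ h_distortion, h_bind⟩).trans_eq ?_
  rw [mutualInformation, h_bind, h_disintegrate]

theorem dpRDF_le_lintegral_klDiv_of_couplings (he : Measurable (Function.uncurry e))
    {π : Measure ι} [IsProbabilityMeasure π] {κ : Kernel ι (E × E)} [IsFiniteKernel κ]
    (h_fst : ∀ i, (κ i).fst = μ) (h_snd : ∀ i, (κ i).snd = μ)
    (h_distortion : ∫⁻ i, ∫⁻ p, (e p.1 p.2 : ℝ≥0∞) ∂(κ i) ∂π ≤ D) :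
    dpRDF μ e D ≤ ∫⁻ i, klDiv (κ i) (μ.prod μ) ∂π := by
  have h_map {g : E × E → E} (hg : Measurable g) (h : ∀ i, (κ i).map g = μ) :
      (κ ∘ₘ π).map g = μ := by
    have h_const : κ.map g = Kernel.const ι μ := by
      ext1 i
      rw [Kernel.map_apply _ hg, h, Kernel.const_apply]
    rw [Measure.map_comp _ _ hg, h_const, Measure.const_comp, measure_univ, one_smul]
  have h_mixture : ∫⁻ p, (e p.1 p.2 : ℝ≥0∞) ∂(κ ∘ₘ π) ≤ D := by
    have he_ennreal : Measurable fun p : E × E ↦ (e p.1 p.2 : ℝ≥0∞) := he.coe_nnreal_ennreal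
    rwa [Measure.lintegral_bind (Kernel.aemeasurable _) he_ennreal.aemeasurable]
  calc dpRDF μ e D
    _ ≤ klDiv (κ ∘ₘ π) (μ.prod μ) :=
      dpRDF_le_klDiv_of_coupling (h_map measurable_fst h_fst) (h_map measurable_snd h_snd) h_mixture
    _ = klDiv (κ ∘ₘ π) (Kernel.const ι (μ.prod μ) ∘ₘ π) := by
      rw [Measure.const_comp, measure_univ, one_smul]
    _ ≤ ∫⁻ i, klDiv (κ i) (μ.prod μ) ∂π := klDiv_comp_le_lintegral π κ (Kernel.const ι (μ.prod μ))

theorem dpRDF_le_inv_mul_sum_mutualInfo {P : Measure Ω} [IsProbabilityMeasure P] {k : ℕ}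
    (hk : 0 < k) (he : Measurable (Function.uncurry e)) {X Y : Ω → Fin k → E} (hX : Measurable X)
    (hY : Measurable Y) (hX_law : ∀ i, P.map (fun ω ↦ X ω i) = μ)
    (hY_law : ∀ i, P.map (fun ω ↦ Y ω i) = μ)
    (h_distortion : ∫⁻ ω, (singleLetterFidelity e (X ω) (Y ω) : ℝ≥0∞) ∂P ≤ D) :
    dpRDF μ e D ≤ (k : ℝ≥0∞)⁻¹ * ∑ i, mutualInfo (fun ω ↦ X ω i) (fun ω ↦ Y ω i) P := by
  have : Nonempty (Fin k) := ⟨⟨0, hk⟩⟩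
  have h_pair (i : Fin k) : Measurable fun ω ↦ (X ω i, Y ω i) := by fun_prop
  let κ : Kernel (Fin k) (E × E) := Kernel.ofFunOfCountable fun i ↦ P.map fun ω ↦ (X ω i, Y ω i)
  have : IsMarkovKernel κ := ⟨fun i ↦ Measure.isProbabilityMeasure_map (h_pair i).aemeasurable⟩
  have h_fst (i : Fin k) : (κ i).fst = μ :=
    (Measure.fst_map_prodMk (by fun_prop)).trans (hX_law i)
  have h_snd (i : Fin k) : (κ i).snd = μ :=
    (Measure.snd_map_prodMk (by fun_prop)).trans (hY_law i)
  have h_average : ∫⁻ i, ∫⁻ p, (e p.1 p.2 : ℝ≥0∞) ∂(κ i) ∂(uniformOn Set.univ) ≤ D := by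
    have h_letter (i : Fin k) :
        ∫⁻ p, (e p.1 p.2 : ℝ≥0∞) ∂(κ i) = ∫⁻ ω, (e (X ω i) (Y ω i) : ℝ≥0∞) ∂P :=
      lintegral_map he.coe_nnreal_ennreal (h_pair i)
    rwa [lintegral_uniformOn_univ, Fintype.card_fin, Finset.sum_congr rfl fun i _ ↦ h_letter i,
      ← lintegral_singleLetterFidelity he hX hY]
  calc dpRDF μ e D
    _ ≤ ∫⁻ i, klDiv (κ i) (μ.prod μ) ∂(uniformOn Set.univ) :=
      dpRDF_le_lintegral_klDiv_of_couplings he h_fst h_snd h_average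
    _ = (k : ℝ≥0∞)⁻¹ * ∑ i, klDiv (κ i) (μ.prod μ) := by
      rw [lintegral_uniformOn_univ, Fintype.card_fin]
    _ = (k : ℝ≥0∞)⁻¹ * ∑ i, mutualInfo (fun ω ↦ X ω i) (fun ω ↦ Y ω i) P := by
      simp only [mutualInfo, hX_law, hY_law]
      rfl

end RateDistortion

theorem mainTheorem3_general {Ω T α E : Type*} [MeasurableSpace Ω] [MeasurableSpace T]
    [MeasurableSpace E] [StandardBorelSpace E] [Fintype α] [Nonempty α] {P : Measure Ω}
    [IsProbabilityMeasure P] {k : ℕ} (hk : 0 < k) {μ : Measure E} [IsProbabilityMeasure μ]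
    {e : E → E → ℝ≥0} (he : Measurable (Function.uncurry e)) {X : Ω → Fin k → E}
    (hX : Measurable X) (hX_law : ∀ i, P.map (fun ω ↦ X ω i) = μ)
    (hX_indep : iIndepFun (fun i ω ↦ X ω i) P) {Θ : Ω → T} (hΘ : Measurable Θ)
    (q : QuantizerEnsemble (Fin k → E) T α) (hXΘ : IndepFun X Θ P)
    (hY_law : ∀ i, P.map (fun ω ↦ q.reconstruction X Θ ω i) = μ) {D : ℝ≥0}
    (hD : ∫⁻ ω, (singleLetterFidelity e (X ω) (q.reconstruction X Θ ω) : ℝ≥0∞) ∂P ≤ D) :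
    dpRDF μ e D ≤ (k : ℝ≥0∞)⁻¹ * q.rate P X Θ := by
  set Y := q.reconstruction X Θ
  have hY : Measurable Y := q.measurable_reconstruction hX hΘ
  have hX_eval (i : Fin k) : Measurable fun ω ↦ X ω i := by fun_prop
  calc dpRDF μ e D
    _ ≤ (k : ℝ≥0∞)⁻¹ * ∑ i, mutualInfo (fun ω ↦ X ω i) (fun ω ↦ Y ω i) P :=
      dpRDF_le_inv_mul_sum_mutualInfo hk he hX hY hX_law hY_law hD
    _ ≤ (k : ℝ≥0∞)⁻¹ * ∑ i, mutualInfo (fun ω ↦ X ω i) Y P := by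
      gcongr with i
      exact mutualInfo_comp_le (hX_eval i) hY measurable_id (measurable_pi_apply i)
    _ ≤ (k : ℝ≥0∞)⁻¹ * mutualInfo X Y P := by
      gcongr
      exact sum_mutualInfo_le_of_iIndepFun hX_eval hY hX_indep
    _ ≤ (k : ℝ≥0∞)⁻¹ * q.rate P X Θ := by
      gcongr
      exact q.mutualInfo_reconstruction_le_rate hX hΘ hXΘ

theorem mainTheorem3 {Ω T α : Type*} [MeasurableSpace Ω] [MeasurableSpace T]
    [Fintype α] [Nontrivial α] (P : Measure Ω) [IsProbabilityMeasure P]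
    (m k : ℕ) (hk : 0 < k)
    (μ : Measure (EuclideanSpace ℝ (Fin m))) [IsProbabilityMeasure μ]
    (e : EuclideanSpace ℝ (Fin m) → EuclideanSpace ℝ (Fin m) → ℝ≥0)
    (he : Measurable (Function.uncurry e))
    (X : Ω → Fin k → EuclideanSpace ℝ (Fin m)) (hX : Measurable X)
    (hX_law : ∀ i, P.map (fun ω => X ω i) = μ)
    (hX_indep : iIndepFun (fun i ω => X ω i) P)
    (Θ : Ω → T) (hΘ : Measurable Θ)
    (q : QuantizerEnsemble (Fin k → EuclideanSpace ℝ (Fin m)) T α)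
    (hq : q.IsDPQ P X Θ)
    (D : ℝ≥0)
    (hD : ∫⁻ ω, (singleLetterFidelity e (X ω) (q.reconstruction X Θ ω) : ℝ≥0∞) ∂P ≤ D) :
    dpRDF μ e D ≤ (k : ℝ≥0∞)⁻¹ * q.rate P X Θ := by
  have h_law : IdentDistrib (q.reconstruction X Θ) X P P :=
    ⟨(q.measurable_reconstruction hX hΘ).aemeasurable, hX.aemeasurable, hq.2⟩
  exact mainTheorem3_general hk he hX hX_law hX_indep hΘ q hq.1
    (fun i ↦ (h_law.comp (measurable_pi_apply i)).map_eq.trans (hX_law i)) hD
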